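/- Let $r\ge 1$ be an integer, let $b_{1,j},b_{2,j}>0$ be real numbers and $k_j\in\mathbb N$ for $j=0,\dots,r$, with $k_0=1$ and $k_0<k_j$ for all $j\in\{1,\dots,r\}$. For $|z|<1$ put $$F(z)=\prod_{j=0}^r\left(1-z^{2k_j}\right)^{-b_{1,j}}\exp\left(\frac{b_{2,j}}{1-z^{k_j}}\right)=\sum_{n\ge 0}f_nz^n$$ (principal powers), where $f_n=F^{(n)}(0)/n!$ and the series converges for all $|z|<1$. For $0\le\rho<1$ let $$A(\rho)=\sum_{j=0}^r\left(2b_{1,j}k_j\frac{\rho^{2k_j}}{1-\rho^{2k_j}}+b_{2,j}k_j\frac{\rho^{k_j}}{(1-\rho^{k_j})^2}\right),$$ $$B(\rho)=\sum_{j=0}^r\left(4b_{1,j}k_j^2\left(\frac{\rho^{2k_j}}{1-\rho^{2k_j}}+\Big(\frac{\rho^{2k_j}}{1-\rho^{2k_j}}\Big)^2\right)+b_{2,j}k_j^2\left(\frac{\rho^{k_j}}{(1-\rho^{k_j})^2}+2\frac{\rho^{2k_j}}{(1-\rho^{k_j})^3}\right)\right).$$ Then $A(\rho)=\rho F'(\rho)/F(\rho)$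 and $B(\rho)=\rho A'(\rho)$ for $0\le\rho<1$, and $F$ is H-admissible on the unit disc. That is, $F$ is holomorphic on $|z|<1$, real and positive at real $\rho<1$ close to $1$, and there is a function $\delta:[0,1]\to(0,\pi)$ such that, as $\rho\to1^-$: (H1) $F(\rho e^{i\theta})\sim F(\rho)\exp\left(i\theta A(\rho)-\tfrac12\theta^2B(\rho)\right)$ uniformly for $|\theta|\le\delta(\rho)$; (H2) $F(\rho e^{i\theta})=o\left(F(\rho)/\sqrt{B(\rho)}\right)$ uniformly for $\delta(\rho)\le|\theta|\le\pi$; (H3) $B(\rho)\to\infty$. Moreover the coefficients satisfy Hayman's Gaussian estimate $$f_n\rho^n=\frac{F(\rho)}{\sqrt{2\pi B(\rho)}}\left(\exp\left(-\frac{(A(\rho)-n)^2}{2B(\rho)}\right)+o(1)\right)\qquad(\rho\to1^-)$$ uniformly for all integers $n\ge0$. Consequently, for every $C>0$, $$f_n\rho^n=\frac{F(\rho)}{\sqrt{2\pi B(\rho)}}\exp\left(-\frac{(A(\rho)-n)^2}{2B(\rho)}\right)(1+o(1))\qquad(\rho\to1^-)$$ uniformly for all integers $n\ge0$ with $|A(\rho)-n|\le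 C\sqrt{B(\rho)}$. -/

import Mathlib

/-- `A(ρ) = ρ F'(ρ) / F(ρ)`, the derivative being that of `ρ ↦ F(ρ)` along the real axis.
Whenever `F` is real and nonzero on the real axis near `ρ` the quotient is real, and `re` only
moves it from `ℂ` to `ℝ`. -/
noncomputable def haymanA (F : ℂ → ℂ) (ρ : ℝ) : ℝ :=
  ((ρ : ℂ) * (1 / F (ρ : ℂ)) * deriv (fun t : ℝ => F (t : ℂ)) ρ).re

/-- `B(ρ) = ρ A'(ρ)`. -/
noncomputable def haymanB (F : ℂ → ℂ) (ρ : ℝ) : ℝ :=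
  ρ * deriv (haymanA F) ρ

/-- `F` is H-admissible on the disc `|z| < R`: it is holomorphic there, real and positive on the
real axis near `R`, and for some angle function `δ` with values in `(0, π)` it satisfies
Hayman's three conditions as `ρ → R` from below. Only the values of `F` on the disc matter. -/
structure IsHAdmissible (R : ℝ) (F : ℂ → ℂ) : Prop where
  radius_pos : 0 < R
  holomorphic : DifferentiableOn ℂ F (Metric.ball (0 : ℂ) R)
  eventually_pos : ∀ᶠ ρ : ℝ in nhdsWithin R (Set.Iio R),
    (F (ρ : ℂ)).im = 0 ∧ 0 < (F (ρ : ℂ)).re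
  exists_angle : ∃ δ : ℝ → ℝ,
    (∀ ρ ∈ Set.Icc (0 : ℝ) R, 0 < δ ρ ∧ δ ρ < Real.pi) ∧
    -- (H1) `F(ρ e^{iθ}) ∼ F(ρ) exp(iθ A(ρ) - θ² B(ρ) / 2)` uniformly for `|θ| ≤ δ(ρ)`
    (∀ ε : ℝ, 0 < ε → ∀ᶠ ρ : ℝ in nhdsWithin R (Set.Iio R), ∀ θ : ℝ, |θ| ≤ δ ρ →
      ‖F ((ρ : ℂ) * Complex.exp (Complex.I * (θ : ℂ)))
          - F (ρ : ℂ) * Complex.exp (Complex.I * (θ : ℂ) * (haymanA F ρ : ℂ)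
              - (1 / 2 : ℂ) * (θ : ℂ) ^ 2 * (haymanB F ρ : ℂ))‖
        ≤ ε * ‖F (ρ : ℂ) * Complex.exp (Complex.I * (θ : ℂ) * (haymanA F ρ : ℂ)
              - (1 / 2 : ℂ) * (θ : ℂ) ^ 2 * (haymanB F ρ : ℂ))‖) ∧
    -- (H2) `F(ρ e^{iθ}) = o(F(ρ) / √B(ρ))` uniformly for `δ(ρ) ≤ |θ| ≤ π`
    (∀ ε : ℝ, 0 < ε → ∀ᶠ ρ : ℝ in nhdsWithin R (Set.Iio R), ∀ θ : ℝ,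
      δ ρ ≤ |θ| → |θ| ≤ Real.pi →
      ‖F ((ρ : ℂ) * Complex.exp (Complex.I * (θ : ℂ)))‖
        ≤ ε * (‖F (ρ : ℂ)‖ / Real.sqrt (haymanB F ρ))) ∧
    -- (H3) `B(ρ) → ∞`
    Filter.Tendsto (haymanB F) (nhdsWithin R (Set.Iio R)) Filter.atTop

/-- `F(z) = ∏_{j=0}^r (1 - z^{2 k_j})^{-b_{1,j}} exp(b_{2,j} / (1 - z^{k_j}))`, with principal
powers; for `|z| < 1` and `k_j ≥ 1` the base `1 - z^{2 k_j}` has positive real part. -/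
noncomputable def genProd (r : ℕ) (b₁ b₂ : Fin (r + 1) → ℝ) (k : Fin (r + 1) → ℕ) (z : ℂ) : ℂ :=
  ∏ j : Fin (r + 1),
    (1 - z ^ (2 * k j)) ^ (-(b₁ j : ℂ)) * Complex.exp ((b₂ j : ℂ) / (1 - z ^ k j))

/-- The `n`-th Taylor coefficient of `F` at `0`. -/
noncomputable def taylorCoeffZero (F : ℂ → ℂ) (n : ℕ) : ℂ :=
  iteratedDeriv n F 0 / (n.factorial : ℂ)

/-- The explicit function `A(ρ)`. -/
noncomputable def explicitA (r : ℕ) (b₁ b₂ : Fin (r + 1) → ℝ) (k : Fin (r + 1) → ℕ)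
    (ρ : ℝ) : ℝ :=
  ∑ j : Fin (r + 1),
    (b₁ j * (2 * (k j : ℝ)) * (ρ ^ (2 * k j) / (1 - ρ ^ (2 * k j)))
      + b₂ j * (k j : ℝ) * (ρ ^ k j / (1 - ρ ^ k j) ^ 2))

/-- The explicit function `B(ρ)`. -/
noncomputable def explicitB (r : ℕ) (b₁ b₂ : Fin (r + 1) → ℝ) (k : Fin (r + 1) → ℕ)
    (ρ : ℝ) : ℝ :=
  ∑ j : Fin (r + 1),
    (4 * b₁ j * (k j : ℝ) ^ 2 *
        (ρ ^ (2 * k j) / (1 - ρ ^ (2 * k j)) + (ρ ^ (2 * k j) / (1 - ρ ^ (2 * k j))) ^ 2)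
      + b₂ j * (k j : ℝ) ^ 2 *
        (ρ ^ k j / (1 - ρ ^ k j) ^ 2 + 2 * (ρ ^ (2 * k j) / (1 - ρ ^ k j) ^ 3)))

/-- The factor `F(ρ) / √(2π B(ρ))`. -/
noncomputable def gaussPrefactor (F : ℂ → ℂ) (B : ℝ → ℝ) (ρ : ℝ) : ℂ :=
  F (ρ : ℂ) / (Real.sqrt (2 * Real.pi * B ρ) : ℂ)

/-- The factor `exp(-(A(ρ) - n)² / (2 B(ρ)))`. -/
noncomputable def gaussFactor (A B : ℝ → ℝ) (ρ : ℝ) (n : ℕ) : ℝ :=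
  Real.exp (-((A ρ - (n : ℝ)) ^ 2 / (2 * B ρ)))

/-- The Taylor coefficients at `0` as integrals over the circle of radius `ρ`. -/
theorem taylorCoeffZero_mul_pow_eq_integral {R ρ : ℝ} {F : ℂ → ℂ}
    (hF : DifferentiableOn ℂ F (Metric.ball (0 : ℂ) R)) (h0 : 0 < ρ) (hR : ρ < R) (n : ℕ) :
    taylorCoeffZero F n * (ρ : ℂ) ^ n = (2 * Real.pi : ℂ)⁻¹ *
      ∫ θ in (-Real.pi)..Real.pi, F (ρ * Complex.exp (Complex.I * θ)) *
        Complex.exp (-(Complex.I * n * θ)) := by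
  have hρ : (ρ : ℂ) ≠ 0 := by exact_mod_cast h0.ne'
  have hd : DiffContOnCl ℂ F (Metric.ball 0 ρ) :=
    (hF.mono (by
      rw [closure_ball _ h0.ne']
      exact Metric.closedBall_subset_ball hR)).diffContOnCl
  have key := hd.circleIntegral_one_div_sub_center_pow_smul h0 n
  have hper : Function.Periodic (fun θ : ℝ => F (ρ * Complex.exp (Complex.I * θ)) *
        Complex.exp (-(Complex.I * n * θ))) (2 * Real.pi) := by
    intro θ
    have h1 : Complex.exp (Complex.I * ((θ + 2 * Real.pi : ℝ) : ℂ)) =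
        Complex.exp (Complex.I * θ) := by
      rw [← Complex.exp_periodic (Complex.I * θ)]
      push_cast; ring_nf
    have h2 : ∀ x : ℝ, Complex.exp (-(Complex.I * n * x)) =
        (Complex.exp (Complex.I * x) ^ n)⁻¹ := by
      intro x
      rw [← Complex.exp_nat_mul, ← Complex.exp_neg]
      ring_nf
    simp only [h2, h1]
  have hshift := hper.intervalIntegral_add_eq (-Real.pi) 0
  rw [show -Real.pi + 2 * Real.pi = Real.pi by ring, zero_add] at hshift
  rw [hshift]
  have hint : (∮ z in C(0, ρ), (1 / (z - 0) ^ (n + 1)) • F z) =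
      Complex.I * ((ρ : ℂ) ^ n)⁻¹ *
        ∫ θ in (0 : ℝ)..(2 * Real.pi), F (ρ * Complex.exp (Complex.I * θ)) *
          Complex.exp (-(Complex.I * n * θ)) := by
    rw [circleIntegral, ← intervalIntegral.integral_const_mul]
    refine intervalIntegral.integral_congr fun θ _ => ?_
    have h2 : Complex.exp (-(Complex.I * n * θ)) = (Complex.exp (θ * Complex.I) ^ n)⁻¹ := by
      rw [← Complex.exp_nat_mul, ← Complex.exp_neg]
      ring_nf
    have he : Complex.exp (θ * Complex.I) ≠ 0 := Complex.exp_ne_zero _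
    simp only [deriv_circleMap, circleMap, zero_add, sub_zero, smul_eq_mul, h2,
      mul_comm Complex.I (θ : ℂ)]
    rw [mul_pow]
    field_simp
    ring
  rw [hint] at key
  have hfac : (n.factorial : ℂ) ≠ 0 := by exact_mod_cast n.factorial_ne_zero
  have hpi : (Real.pi : ℂ) ≠ 0 := by exact_mod_cast Real.pi_ne_zero
  rw [smul_eq_mul] at key
  set J := ∫ θ in (0 : ℝ)..(2 * Real.pi), F (ρ * Complex.exp (Complex.I * θ)) *
          Complex.exp (-(Complex.I * n * θ))
  have hJ : J = (ρ : ℂ) ^ n * (2 * Real.pi / n.factorial) * iteratedDeriv n F 0 := by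
    have hI := Complex.I_ne_zero
    have : Complex.I * J = Complex.I *
        ((ρ : ℂ) ^ n * (2 * Real.pi / n.factorial) * iteratedDeriv n F 0) := by
      have h3 := congrArg (fun w => (ρ : ℂ) ^ n * w) key
      rw [show (ρ : ℂ) ^ n * (Complex.I * ((ρ : ℂ) ^ n)⁻¹ * J) = Complex.I * J by
        field_simp] at h3
      rw [h3]; ring
    exact mul_left_cancel₀ hI this
  rw [hJ, taylorCoeffZero]
  field_simp

/-- The Gaussian with a complex linear phase, integrated over the line. -/
theorem integral_cexp_I_mul_sub_sq {B : ℝ} (hB : 0 < B) (t : ℝ) :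
    ∫ θ : ℝ, Complex.exp (Complex.I * θ * t - (1 / 2 : ℂ) * θ ^ 2 * B) =
      (Real.sqrt (2 * Real.pi / B) * Real.exp (-(t ^ 2 / (2 * B))) : ℝ) := by
  have hb : 0 < ((B / 2 : ℝ) : ℂ).re := by simpa using hB
  have h := fourierIntegral_gaussian hb (t : ℂ)
  simp_rw [← Complex.exp_add] at h
  have hs : ((Real.pi : ℂ) / ((B / 2 : ℝ) : ℂ)) ^ (1 / 2 : ℂ) =
      (Real.sqrt (2 * Real.pi / B) : ℝ) := by
    rw [Real.sqrt_eq_rpow, Complex.ofReal_cpow (by positivity)]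
    push_cast
    congr 1
    field_simp
  rw [hs] at h
  rw [Complex.ofReal_mul, Complex.ofReal_exp]
  convert h using 2
  · ext θ
    congr 1
    push_cast; ring
  · congr 1
    push_cast
    field_simp; ring

/-- Laplace's method on one circle with explicit errors: if `g` is close to
`P exp (iθA - θ²B/2)` on `[-δ, δ]` and small on the rest of `[-π, π]`, its Fourier
coefficients are close to Gaussian. -/
theorem norm_fourierCoeff_sub_gaussian_le {g : ℝ → ℂ} {P : ℂ} {A B δ η : ℝ} (hg : Continuous g)
    (hB : 0 < B) (hδ : 0 < δ) (hδπ : δ < Real.pi) (hη : 0 ≤ η)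
    (h1 : ∀ θ : ℝ, |θ| ≤ δ →
      ‖g θ - P * Complex.exp (Complex.I * θ * A - (1 / 2 : ℂ) * θ ^ 2 * B)‖ ≤
        η * ‖P * Complex.exp (Complex.I * θ * A - (1 / 2 : ℂ) * θ ^ 2 * B)‖)
    (h2 : ∀ θ : ℝ, δ ≤ |θ| → |θ| ≤ Real.pi → ‖g θ‖ ≤ η * (‖P‖ / Real.sqrt B))
    (h3 : Real.exp (-(B * δ ^ 2 / 4)) ≤ η) (n : ℕ) :
    ‖(2 * Real.pi : ℂ)⁻¹ * (∫ θ in (-Real.pi)..Real.pi, g θ * Complex.exp (-(Complex.I * n * θ)))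
        - P / (Real.sqrt (2 * Real.pi * B) : ℂ) * (Real.exp (-((A - n) ^ 2 / (2 * B))) : ℂ)‖
      ≤ 5 * η * ‖P / (Real.sqrt (2 * Real.pi * B) : ℂ)‖ := by
  have hpi := Real.pi_pos
  set s := Real.sqrt B with hs
  have hs0 : 0 < s := Real.sqrt_pos.2 hB
  have hss : s ^ 2 = B := Real.sq_sqrt hB.le
  set S := Set.Ioc (-Real.pi) Real.pi with hS
  set h : ℝ → ℂ := fun θ => P * Complex.exp (Complex.I * θ * (A - n : ℝ) -
    (1 / 2 : ℂ) * θ ^ 2 * B) with hh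
  set u : ℝ → ℂ := fun θ => g θ * Complex.exp (-(Complex.I * n * θ)) with hu
  have hnormE : ∀ (t : ℝ) (θ : ℝ),
      ‖Complex.exp (Complex.I * θ * t - (1 / 2 : ℂ) * θ ^ 2 * B)‖ =
        Real.exp (-(θ ^ 2 * B / 2)) := by
    intro t θ
    rw [Complex.norm_exp]
    congr 1
    have : Complex.I * θ * t - (1 / 2 : ℂ) * θ ^ 2 * B =
      ((-(θ ^ 2 * B / 2) : ℝ) : ℂ) + ((θ * t : ℝ) : ℂ) * Complex.I := by push_cast; ring
    rw [this, Complex.add_re, Complex.ofReal_re, Complex.re_ofReal_mul, Complex.I_re, mul_zero,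
      add_zero]
  have hgauss2 : MeasureTheory.Integrable (fun θ : ℝ => Real.exp (-(B / 2) * θ ^ 2)) :=
    integrable_exp_neg_mul_sq (by positivity)
  have hgauss4 : MeasureTheory.Integrable (fun θ : ℝ => Real.exp (-(B / 4) * θ ^ 2)) :=
    integrable_exp_neg_mul_sq (by positivity)
  have hhint : MeasureTheory.Integrable h := by
    refine (hgauss2.const_mul ‖P‖).mono' ?_ (Filter.Eventually.of_forall fun θ => ?_)
    · exact Continuous.aestronglyMeasurable (by fun_prop)
    · simp only [hh]
      rw [norm_mul, hnormE]
      apply le_of_eq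
      ring_nf
  have huc : Continuous u := by fun_prop
  have huint : MeasureTheory.Integrable (S.indicator u) := by
    rw [MeasureTheory.integrable_indicator_iff measurableSet_Ioc]
    exact huc.integrableOn_Ioc
  have hI1 : (∫ θ in (-Real.pi)..Real.pi, u θ) = ∫ θ, S.indicator u θ := by
    rw [MeasureTheory.integral_indicator measurableSet_Ioc,
      intervalIntegral.integral_of_le (by linarith)]
  have hI2 : ∫ θ, h θ = P * (Real.sqrt (2 * Real.pi / B) *
      Real.exp (-((A - n) ^ 2 / (2 * B))) : ℝ) := by
    simp only [hh]
    rw [MeasureTheory.integral_const_mul, integral_cexp_I_mul_sub_sq hB]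
  set w : ℝ → ℝ := fun θ => S.indicator (fun _ => η * (‖P‖ / s)) θ +
    η * ‖P‖ * Real.exp (-(B / 4) * θ ^ 2) with hw
  have hc : MeasureTheory.Integrable (S.indicator (fun _ : ℝ => η * (‖P‖ / s))) := by
    rw [MeasureTheory.integrable_indicator_iff measurableSet_Ioc]
    exact continuous_const.integrableOn_Ioc
  have hwint : MeasureTheory.Integrable w := hc.add (hgauss4.const_mul _)
  have hmono : ∀ θ : ℝ, Real.exp (-(θ ^ 2 * B / 2)) ≤ Real.exp (-(B / 4) * θ ^ 2) := by
    intro θ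
    apply Real.exp_le_exp.2
    nlinarith [mul_nonneg hB.le (sq_nonneg θ)]
  have htail : ∀ θ : ℝ, δ ≤ |θ| →
      Real.exp (-(θ ^ 2 * B / 2)) ≤ η * Real.exp (-(B / 4) * θ ^ 2) := by
    intro θ hθ
    have hsq : δ ^ 2 ≤ θ ^ 2 := by
      rw [← sq_abs θ]; exact pow_le_pow_left₀ hδ.le hθ 2
    calc Real.exp (-(θ ^ 2 * B / 2))
        ≤ Real.exp (-(B * δ ^ 2 / 4) + -(B / 4) * θ ^ 2) := by
          apply Real.exp_le_exp.2
          nlinarith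
      _ ≤ _ := by rw [Real.exp_add]; gcongr
  have hpt : ∀ θ, ‖S.indicator u θ - h θ‖ ≤ w θ := by
    intro θ
    have hE0 := Real.exp_pos (-(B / 4) * θ ^ 2)
    have hP := norm_nonneg P
    have hhn : ‖h θ‖ = ‖P‖ * Real.exp (-(θ ^ 2 * B / 2)) := by
      simp only [hh]; rw [norm_mul, hnormE]
    have hconst : 0 ≤ η * (‖P‖ / s) := by positivity
    have hphase : ‖Complex.exp (-(Complex.I * n * θ))‖ = 1 := by
      rw [show -(Complex.I * n * θ) = ((-(n * θ) : ℝ) : ℂ) * Complex.I by push_cast; ring,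
        Complex.norm_exp_ofReal_mul_I]
    by_cases hθS : θ ∈ S
    · have hθpi : |θ| ≤ Real.pi := abs_le.2 ⟨hθS.1.le, hθS.2⟩
      simp only [hw, Set.indicator_of_mem hθS]
      rcases le_total |θ| δ with hle | hle
      · have hfac : u θ - h θ = Complex.exp (-(Complex.I * n * θ)) *
            (g θ - P * Complex.exp (Complex.I * θ * A - (1 / 2 : ℂ) * θ ^ 2 * B)) := by
          simp only [hu, hh]
          rw [mul_sub, mul_comm, mul_left_comm, ← Complex.exp_add]
          congr 3
          push_cast; ring
        rw [hfac, norm_mul, hphase, one_mul]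
        refine (h1 θ hle).trans ?_
        rw [norm_mul, hnormE]
        have := mul_le_mul_of_nonneg_left (hmono θ) (mul_nonneg hη hP)
        nlinarith
      · refine (norm_sub_le _ _).trans (add_le_add ?_ ?_)
        · simp only [hu]
          rw [norm_mul, hphase, mul_one]
          exact h2 θ hle hθpi
        · rw [hhn]
          have := mul_le_mul_of_nonneg_left (htail θ hle) hP
          nlinarith
    · simp only [hw, Set.indicator_of_notMem hθS, zero_sub, norm_neg, zero_add]
      rw [hhn]
      have hle : δ ≤ |θ| := by
        by_contra hlt
        have := abs_lt.1 ((not_le.1 hlt).trans hδπ)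
        exact hθS ⟨this.1, this.2.le⟩
      have := mul_le_mul_of_nonneg_left (htail θ hle) hP
      nlinarith
  have hwval : ∫ θ, w θ = η * (‖P‖ / s) * (2 * Real.pi) +
      η * ‖P‖ * Real.sqrt (Real.pi / (B / 4)) := by
    simp only [hw]
    rw [MeasureTheory.integral_add hc (hgauss4.const_mul _), MeasureTheory.integral_const_mul,
      integral_gaussian, MeasureTheory.integral_indicator measurableSet_Ioc]
    simp only [MeasureTheory.integral_const, smul_eq_mul,
      MeasureTheory.measureReal_restrict_apply_univ, Real.volume_real_Ioc]
    rw [max_eq_left (by linarith)]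
    ring
  have hmain : ‖(∫ θ in (-Real.pi)..Real.pi, u θ) - ∫ θ, h θ‖ ≤ ∫ θ, w θ := by
    rw [hI1, ← MeasureTheory.integral_sub huint hhint]
    exact MeasureTheory.norm_integral_le_of_norm_le hwint (Filter.Eventually.of_forall hpt)
  set q := Real.sqrt (2 * Real.pi) with hq
  have hq0 : 0 < q := Real.sqrt_pos.2 (by positivity)
  have hqq : q ^ 2 = 2 * Real.pi := Real.sq_sqrt (by positivity)
  have hq3 : q ≤ 3 := by
    have := Real.pi_lt_d2
    nlinarith
  have hs1 : Real.sqrt (2 * Real.pi * B) = q * s := Real.sqrt_mul (by positivity) _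
  have hs2 : Real.sqrt (2 * Real.pi / B) = q / s := Real.sqrt_div (by positivity) _
  have hs4 : Real.sqrt (Real.pi / (B / 4)) ≤ 2 * (q / s) := by
    rw [Real.sqrt_le_left (by positivity), mul_pow, div_pow, hqq, hss]
    rw [div_div_eq_mul_div, mul_div_assoc']
    exact div_le_div_of_nonneg_right (by linarith) hB.le
  have hqC : (q : ℂ) ≠ 0 := by exact_mod_cast hq0.ne'
  have hsC : (s : ℂ) ≠ 0 := by exact_mod_cast hs0.ne'
  have hqqC : (2 * Real.pi : ℂ) = (q : ℂ) ^ 2 := by exact_mod_cast hqq.symm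
  have hcent : P / (Real.sqrt (2 * Real.pi * B) : ℂ) *
      (Real.exp (-((A - n) ^ 2 / (2 * B))) : ℂ) = (2 * Real.pi : ℂ)⁻¹ * ∫ θ, h θ := by
    rw [hI2, hs1, hs2, hqqC]
    push_cast
    field_simp
  rw [hcent, ← mul_sub, norm_mul, norm_inv, hqqC, hs1, norm_pow, Complex.norm_real,
    Real.norm_of_nonneg hq0.le, norm_div, Complex.norm_real,
    Real.norm_of_nonneg (by positivity : 0 ≤ q * s)]
  refine (mul_le_mul_of_nonneg_left (hmain.trans hwval.le) (by positivity)).trans ?_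
  calc (q ^ 2)⁻¹ * (η * (‖P‖ / s) * (2 * Real.pi) + η * ‖P‖ * Real.sqrt (Real.pi / (B / 4)))
      ≤ (q ^ 2)⁻¹ * (η * (‖P‖ / s) * q ^ 2 + η * ‖P‖ * (2 * (q / s))) := by
        rw [← hqq]; gcongr
    _ = (q + 2) * η * (‖P‖ / (q * s)) := by field_simp
    _ ≤ 5 * η * (‖P‖ / (q * s)) := by gcongr; linarith

/-- **Hayman's theorem**: the Taylor coefficients of an H-admissible function are uniformly
Gaussian. -/
theorem IsHAdmissible.taylorCoeffZero_gaussian {R : ℝ} {F : ℂ → ℂ} (hF : IsHAdmissible R F)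
    {ε : ℝ} (hε : 0 < ε) : ∀ᶠ ρ : ℝ in nhdsWithin R (Set.Iio R), ∀ n : ℕ,
      ‖taylorCoeffZero F n * (ρ : ℂ) ^ n
          - gaussPrefactor F (haymanB F) ρ * (gaussFactor (haymanA F) (haymanB F) ρ n : ℂ)‖
        ≤ ε * ‖gaussPrefactor F (haymanB F) ρ‖ := by
  obtain ⟨δ, hδ, H1, H2, H3⟩ := hF.exists_angle
  set η := min (ε / 5) (1 / 2) with hη
  have hη0 : 0 < η := by positivity
  have hη1 : η ≤ ε / 5 := min_le_left _ _
  have hη2 : η ≤ 1 / 2 := min_le_right _ _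
  have hη4 : η ^ 2 / 2 ≤ η := by nlinarith
  have hpos : ∀ᶠ ρ : ℝ in nhdsWithin R (Set.Iio R), 0 < ρ :=
    nhdsWithin_le_nhds (lt_mem_nhds hF.radius_pos)
  filter_upwards [H1 η hη0, H2 (η ^ 2 / 2) (by positivity), H3.eventually_ge_atTop 1, hpos,
    self_mem_nhdsWithin, hF.eventually_pos] with ρ h1 h2 hB hρ hρR hP n
  obtain ⟨hδ0, hδπ⟩ := hδ ρ ⟨hρ.le, le_of_lt hρR⟩
  have hB0 : 0 < haymanB F ρ := by linarith
  have hP0 : 0 < ‖F ρ‖ := by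
    rw [norm_pos_iff]
    intro h
    rw [h] at hP
    exact lt_irrefl _ hP.2
  have hcont : Continuous fun θ : ℝ => F (ρ * Complex.exp (Complex.I * θ)) := by
    refine hF.holomorphic.continuousOn.comp_continuous (by fun_prop) fun θ => ?_
    rw [mem_ball_zero_iff, norm_mul, Complex.norm_exp_I_mul_ofReal, mul_one, Complex.norm_real,
      Real.norm_of_nonneg hρ.le]
    exact hρR
  have h3 : Real.exp (-(haymanB F ρ * δ ρ ^ 2 / 4)) ≤ η := by
    have e1 := h1 (δ ρ) (abs_of_pos hδ0).le
    have e2 := h2 (δ ρ) (le_abs_self _) (by rw [abs_of_pos hδ0]; exact hδπ.le)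
    set E := F ρ * Complex.exp (Complex.I * (δ ρ : ℂ) * haymanA F ρ -
      (1 / 2 : ℂ) * (δ ρ : ℂ) ^ 2 * haymanB F ρ) with hE
    have hEn : ‖E‖ = ‖F ρ‖ * Real.exp (-(haymanB F ρ * δ ρ ^ 2 / 4)) ^ 2 := by
      rw [hE, norm_mul, Complex.norm_exp, ← Real.exp_nat_mul]
      congr 2
      rw [show Complex.I * (δ ρ : ℂ) * haymanA F ρ - (1 / 2 : ℂ) * (δ ρ : ℂ) ^ 2 * haymanB F ρ =
        ((-(haymanB F ρ * δ ρ ^ 2 / 2) : ℝ) : ℂ) + ((δ ρ * haymanA F ρ : ℝ) : ℂ) * Complex.I by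
          push_cast; ring, Complex.add_re, Complex.ofReal_re, Complex.re_ofReal_mul,
        Complex.I_re]
      push_cast; ring
    have hsq : 1 ≤ Real.sqrt (haymanB F ρ) := Real.one_le_sqrt.2 hB
    have e3 : ‖F ρ‖ / Real.sqrt (haymanB F ρ) ≤ ‖F ρ‖ := div_le_self hP0.le hsq
    have e4 := norm_sub_norm_le E (F (ρ * Complex.exp (Complex.I * (δ ρ : ℂ))))
    rw [norm_sub_rev] at e4
    have e5 : ‖E‖ ≤ η ^ 2 * ‖F ρ‖ := by
      have := mul_le_mul_of_nonneg_right hη2 (norm_nonneg E)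
      have := mul_le_mul_of_nonneg_left e3 (by positivity : 0 ≤ η ^ 2 / 2)
      linarith
    rw [hEn, mul_comm] at e5
    exact le_of_sq_le_sq (le_of_mul_le_mul_right e5 hP0) hη0.le
  rw [taylorCoeffZero_mul_pow_eq_integral hF.holomorphic hρ hρR, gaussPrefactor, gaussFactor]
  refine (norm_fourierCoeff_sub_gaussian_le hcont hB0 hδ0 hδπ hη0.le (fun θ hθ => h1 θ hθ)
    (fun θ hθ hθ' => (h2 θ hθ hθ').trans ?_) h3 n).trans ?_
  · gcongr
  · gcongr
    linarith

/-- In the central range the uniform Gaussian estimate has a small relative error. -/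
theorem gaussian_relative_error {F : ℂ → ℂ} {A B : ℝ → ℝ} {l : Filter ℝ}
    (hB : ∀ᶠ ρ in l, 0 < B ρ)
    (h : ∀ ε : ℝ, 0 < ε → ∀ᶠ ρ : ℝ in l, ∀ n : ℕ,
      ‖taylorCoeffZero F n * (ρ : ℂ) ^ n - gaussPrefactor F B ρ * (gaussFactor A B ρ n : ℂ)‖
        ≤ ε * ‖gaussPrefactor F B ρ‖) (C : ℝ) {ε : ℝ} (hε : 0 < ε) :
    ∀ᶠ ρ : ℝ in l, ∀ n : ℕ, |A ρ - (n : ℝ)| ≤ C * Real.sqrt (B ρ) →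
      ‖taylorCoeffZero F n * (ρ : ℂ) ^ n - gaussPrefactor F B ρ * (gaussFactor A B ρ n : ℂ)‖
        ≤ ε * ‖gaussPrefactor F B ρ * (gaussFactor A B ρ n : ℂ)‖ := by
  filter_upwards [hB, h (ε * Real.exp (-(C ^ 2 / 2))) (by positivity)] with ρ hBρ hρ n hn
  refine (hρ n).trans ?_
  have hg : Real.exp (-(C ^ 2 / 2)) ≤ gaussFactor A B ρ n := by
    apply Real.exp_le_exp.2
    have h2 : (A ρ - n) ^ 2 ≤ C ^ 2 * B ρ := by
      rw [← sq_abs, ← Real.sq_sqrt hBρ.le, ← mul_pow]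
      exact pow_le_pow_left₀ (abs_nonneg _) hn 2
    rw [neg_le_neg_iff, div_le_div_iff₀ (by positivity) (by positivity)]
    linarith
  rw [norm_mul, Complex.norm_real, Real.norm_of_nonneg (Real.exp_pos _ |>.le.trans hg),
    mul_assoc, mul_comm ‖gaussPrefactor F B ρ‖]
  gcongr

theorem norm_exp_I_mul_sub_taylor_le (y : ℝ) :
    ‖Complex.exp (Complex.I * y) - 1 - Complex.I * y + (y : ℂ) ^ 2 / 2‖ ≤ 4 * |y| ^ 3 := by
  have hIy : ‖Complex.I * (y : ℂ)‖ = |y| := by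
    rw [norm_mul, Complex.norm_I, one_mul, Complex.norm_real, Real.norm_eq_abs]
  rcases le_total |y| 1 with hy | hy
  · have h := Complex.exp_bound (x := Complex.I * y) (by rwa [hIy]) (n := 3) (by norm_num)
    rw [hIy] at h
    have e : Complex.exp (Complex.I * y) - ∑ m ∈ Finset.range 3,
        (Complex.I * (y : ℂ)) ^ m / (m.factorial : ℂ) =
        Complex.exp (Complex.I * y) - 1 - Complex.I * y + (y : ℂ) ^ 2 / 2 := by
      simp only [Finset.sum_range_succ, Finset.sum_range_zero, mul_pow, Complex.I_sq]
      norm_num [Nat.factorial]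
      ring
    rw [e] at h
    refine h.trans ?_
    norm_num [Nat.factorial]
    nlinarith [pow_nonneg (abs_nonneg y) 3]
  · have h1 : ‖Complex.exp (Complex.I * y)‖ = 1 := Complex.norm_exp_I_mul_ofReal y
    have h2 : ‖(y : ℂ) ^ 2 / 2‖ = |y| ^ 2 / 2 := by simp
    have h := (norm_add_le (Complex.exp (Complex.I * y) - 1 - Complex.I * y) ((y : ℂ) ^ 2 / 2))
    have h' := norm_sub_le (Complex.exp (Complex.I * y) - 1) (Complex.I * y)
    have h'' := norm_sub_le (Complex.exp (Complex.I * y)) 1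
    rw [h2] at h
    rw [hIy] at h'
    rw [h1, norm_one] at h''
    have e2 : |y| ≤ |y| ^ 2 := by nlinarith
    have e3 : |y| ^ 2 ≤ |y| ^ 3 := by nlinarith [sq_nonneg |y|]
    linarith

/-- Second-order expansion in the angle of a power series with coefficients in `[0, 1]`. -/
theorem norm_hasSum_angle_expansion_le {c : ℕ → ℝ} (hc : ∀ m, |c m| ≤ 1) {x φ : ℝ} (hx0 : 0 ≤ x)
    (hx1 : x < 1) {S : ℂ} {S₀ S₁ S₂ : ℝ}
    (hS : HasSum (fun m : ℕ => (c m : ℂ) * (x * Complex.exp (Complex.I * φ)) ^ m) S)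
    (h0 : HasSum (fun m : ℕ => c m * x ^ m) S₀)
    (h1 : HasSum (fun m : ℕ => m * (c m * x ^ m)) S₁)
    (h2 : HasSum (fun m : ℕ => (m : ℝ) ^ 2 * (c m * x ^ m)) S₂) :
    ‖S - S₀ - Complex.I * φ * S₁ + (φ : ℂ) ^ 2 / 2 * S₂‖ ≤ 24 * |φ| ^ 3 / (1 - x) ^ 4 := by
  have hsum := ((hS.sub (Complex.hasSum_ofReal.2 h0)).sub
    ((Complex.hasSum_ofReal.2 h1).mul_left (Complex.I * φ))).add
    ((Complex.hasSum_ofReal.2 h2).mul_left ((φ : ℂ) ^ 2 / 2))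
  have hg := (hasSum_choose_mul_geometric_of_norm_lt_one 3 (r := x)
    (by rwa [Real.norm_of_nonneg hx0])).mul_left (24 * |φ| ^ 3)
  rw [← hsum.tsum_eq]
  refine (tsum_of_norm_bounded hg fun m => ?_).trans (by
    rw [mul_one_div])
  have e : (c m : ℂ) * (x * Complex.exp (Complex.I * φ)) ^ m - ((c m * x ^ m : ℝ) : ℂ) -
      Complex.I * φ * ((m * (c m * x ^ m) : ℝ) : ℂ) +
      (φ : ℂ) ^ 2 / 2 * (((m : ℝ) ^ 2 * (c m * x ^ m) : ℝ) : ℂ) =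
      ((c m * x ^ m : ℝ) : ℂ) * (Complex.exp (Complex.I * (m * φ : ℝ)) - 1 -
        Complex.I * (m * φ : ℝ) + ((m * φ : ℝ) : ℂ) ^ 2 / 2) := by
    rw [mul_pow, ← Complex.exp_nat_mul,
      show (m : ℂ) * (Complex.I * φ) = Complex.I * (m * φ : ℝ) by push_cast; ring]
    push_cast; ring
  rw [e, norm_mul, Complex.norm_real, Real.norm_eq_abs, abs_mul, abs_of_nonneg (pow_nonneg hx0 m)]
  have hchoose : (m : ℝ) ^ 3 ≤ 6 * ((m + 3).choose 3 : ℝ) := by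
    have h := Nat.descFactorial_eq_factorial_mul_choose (m + 3) 3
    have h6 : Nat.factorial 3 = 6 := rfl
    have hN : m ^ 3 ≤ 6 * (m + 3).choose 3 := by
      rw [h6] at h
      rw [← h]
      exact (Nat.pow_le_pow_left (by omega) 3).trans (Nat.pow_sub_le_descFactorial (m + 3) 3)
    exact_mod_cast hN
  have hmφ : |(m : ℝ) * φ| ^ 3 = m ^ 3 * |φ| ^ 3 := by
    rw [abs_mul, Nat.abs_cast, mul_pow]
  have hφ : 0 ≤ |φ| ^ 3 := by positivity
  calc |c m| * x ^ m * ‖Complex.exp (Complex.I * (m * φ : ℝ)) - 1 -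
        Complex.I * (m * φ : ℝ) + ((m * φ : ℝ) : ℂ) ^ 2 / 2‖
      ≤ 1 * x ^ m * (4 * (6 * ((m + 3).choose 3 : ℝ) * |φ| ^ 3)) := by
        gcongr
        · exact hc m
        · refine (norm_exp_I_mul_sub_taylor_le _).trans ?_
          rw [hmφ]
          gcongr
    _ = _ := by ring

theorem hasSum_sq_mul_geometric {x : ℝ} (hx : |x| < 1) :
    HasSum (fun m : ℕ => (m : ℝ) ^ 2 * x ^ m) (x / (1 - x) ^ 2 + 2 * (x ^ 2 / (1 - x) ^ 3)) := by
  have h2 := (hasSum_choose_mul_geometric_of_norm_lt_one 2 (r := x) hx).mul_left 2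
  have h1 := (hasSum_coe_mul_geometric_of_norm_lt_one (r := x) hx).mul_left 3
  have h0 := (hasSum_geometric_of_norm_lt_one (ξ := x) hx).mul_left 2
  have hx1 : 1 - x ≠ 0 := by
    have := (abs_lt.1 hx).2
    linarith
  have hval : x / (1 - x) ^ 2 + 2 * (x ^ 2 / (1 - x) ^ 3) =
      2 * (1 / (1 - x) ^ (2 + 1)) - 3 * (x / (1 - x) ^ 2) - 2 * (1 - x)⁻¹ := by
    field_simp
    ring
  rw [hval]
  refine ((h2.sub h1).sub h0).congr_fun fun m => ?_
  have hN : (((m + 2).choose 2 : ℕ) : ℝ) = (m + 2) * (m + 1) / 2 := by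
    rw [Nat.cast_choose_two]; push_cast; ring
  rw [hN]; ring

theorem norm_one_div_one_sub_expansion_le {x : ℝ} (hx0 : 0 ≤ x) (hx1 : x < 1) (φ : ℝ) :
    ‖1 / (1 - x * Complex.exp (Complex.I * φ)) - (1 / (1 - x) : ℝ) -
        Complex.I * φ * (x / (1 - x) ^ 2 : ℝ) +
        (φ : ℂ) ^ 2 / 2 * (x / (1 - x) ^ 2 + 2 * (x ^ 2 / (1 - x) ^ 3) : ℝ)‖ ≤
      24 * |φ| ^ 3 / (1 - x) ^ 4 := by
  have habs : |x| < 1 := by rwa [abs_of_nonneg hx0]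
  have hz : ‖(x : ℂ) * Complex.exp (Complex.I * φ)‖ < 1 := by
    rw [norm_mul, Complex.norm_exp_I_mul_ofReal, mul_one, Complex.norm_real]
    exact habs
  refine norm_hasSum_angle_expansion_le (c := fun _ => 1) (fun _ => by simp) hx0 hx1 ?_ ?_ ?_ ?_
  · simpa using hasSum_geometric_of_norm_lt_one hz
  · simpa using hasSum_geometric_of_norm_lt_one (ξ := x) habs
  · simpa using hasSum_coe_mul_geometric_of_norm_lt_one (r := x) habs
  · simpa using hasSum_sq_mul_geometric habs

theorem norm_neg_log_one_sub_expansion_le {x : ℝ} (hx0 : 0 ≤ x) (hx1 : x < 1) (φ : ℝ) :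
    ‖-Complex.log (1 - x * Complex.exp (Complex.I * φ)) - (-Real.log (1 - x) : ℝ) -
        Complex.I * φ * (x / (1 - x) : ℝ) +
        (φ : ℂ) ^ 2 / 2 * (x / (1 - x) + (x / (1 - x)) ^ 2 : ℝ)‖ ≤
      24 * |φ| ^ 3 / (1 - x) ^ 4 := by
  have habs : |x| < 1 := by rwa [abs_of_nonneg hx0]
  have hx : 1 - x ≠ 0 := by linarith
  have hz : ‖(x : ℂ) * Complex.exp (Complex.I * φ)‖ < 1 := by
    rw [norm_mul, Complex.norm_exp_I_mul_ofReal, mul_one, Complex.norm_real]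
    exact habs
  have hcoef : ∀ m : ℕ, (m : ℝ) * ((m : ℝ)⁻¹ * x ^ m) = x ^ m - if m = 0 then 1 else 0 := by
    intro m
    rcases eq_or_ne m 0 with rfl | hm
    · simp
    · have : (m : ℝ) ≠ 0 := by exact_mod_cast hm
      simp [hm]
  refine norm_hasSum_angle_expansion_le (c := fun m => (m : ℝ)⁻¹) (fun m => ?_) hx0 hx1
    ?_ ?_ ?_ ?_
  · rw [abs_of_nonneg (by positivity)]
    exact Nat.cast_inv_le_one m
  · convert Complex.hasSum_taylorSeries_neg_log hz using 2 with m
    push_cast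
    rw [div_eq_inv_mul]
  · rw [← Complex.hasSum_ofReal]
    convert Complex.hasSum_taylorSeries_neg_log (z := (x : ℂ))
      (by rwa [Complex.norm_real]) using 1
    · ext m
      push_cast
      rw [div_eq_inv_mul]
    · rw [Complex.ofReal_neg, Complex.ofReal_log (by linarith)]
      push_cast; rfl
  · simp_rw [hcoef]
    rw [show x / (1 - x) = (1 - x)⁻¹ - 1 by field_simp; ring]
    exact (hasSum_geometric_of_norm_lt_one (ξ := x) habs).sub (hasSum_ite_eq 0 (1 : ℝ))
  · rw [show x / (1 - x) + (x / (1 - x)) ^ 2 = x / (1 - x) ^ 2 by field_simp; ring]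
    refine (hasSum_coe_mul_geometric_of_norm_lt_one (r := x) habs).congr_fun fun m => ?_
    rcases eq_or_ne m 0 with rfl | hm
    · simp
    · have : (m : ℝ) ≠ 0 := by exact_mod_cast hm
      field_simp

/-- `1 / (1 - ρ)` exceeds `Re (1 / (1 - z))` on `|z| = ρ` away from the positive axis. -/
theorem le_one_div_sub_re_one_div_one_sub {ρ θ v : ℝ} (hρ : 1 / 2 ≤ ρ) (hρ1 : ρ < 1) (hv : 0 ≤ v)
    (hv1 : v ≤ (1 - ρ) ^ 2) (hθ : v ≤ 1 - Real.cos θ) :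
    v / (4 * (1 - ρ) ^ 3) ≤
      1 / (1 - ρ) - (1 / (1 - ρ * Complex.exp (Complex.I * θ))).re := by
  set t := 1 - Real.cos θ with ht
  set e := 1 - ρ with he
  have he0 : 0 < e := by linarith
  have ht0 : 0 ≤ t := hv.trans hθ
  have hD : 0 < e ^ 2 + 2 * ρ * t := by positivity
  have hre : (1 / (1 - ρ * Complex.exp (Complex.I * θ))).re =
      (1 - ρ * Real.cos θ) / (e ^ 2 + 2 * ρ * t) := by
    rw [mul_comm Complex.I, Complex.exp_mul_I, ← Complex.ofReal_cos, ← Complex.ofReal_sin,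
      one_div, Complex.inv_re]
    congr 1
    · simp only [Complex.sub_re, Complex.one_re, Complex.mul_re, Complex.ofReal_re,
        Complex.add_re, Complex.I_re, mul_zero, Complex.ofReal_im, Complex.I_im, mul_one,
        sub_self, add_zero, zero_mul, sub_zero]
    · rw [Complex.normSq_apply]
      simp only [Complex.sub_re, Complex.one_re, Complex.mul_re, Complex.ofReal_re,
        Complex.add_re, Complex.I_re, mul_zero, Complex.ofReal_im, Complex.I_im, mul_one,
        sub_self, add_zero, Complex.add_im, Complex.mul_im, zero_mul, sub_zero, Complex.sub_im,
        Complex.one_im, zero_add, zero_sub]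
      have := Real.sin_sq_add_cos_sq θ
      rw [he, ht]
      linear_combination ρ ^ 2 * this
  have hid : 1 / e - (1 - ρ * Real.cos θ) / (e ^ 2 + 2 * ρ * t) =
      ρ * (1 + ρ) * t / (e * (e ^ 2 + 2 * ρ * t)) := by
    have hc : Real.cos θ = 1 - t := by rw [ht]; ring
    have hr : ρ = 1 - e := by rw [he]; ring
    rw [div_sub_div _ _ he0.ne' hD.ne', hc]
    congr 1
    rw [hr]; ring
  rw [hre, hid, div_le_div_iff₀ (by positivity) (by positivity)]
  have h1 : e ^ 2 + 2 * ρ * t ≤ e ^ 2 + 2 * t := by nlinarith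
  have h2 : v * (e ^ 2 + 2 * t) ≤ 3 * (t * e ^ 2) := by
    nlinarith [mul_le_mul_of_nonneg_right hθ (sq_nonneg e),
      mul_le_mul_of_nonneg_left hv1 ht0]
  have h3 : 3 / 4 ≤ ρ * (1 + ρ) := by nlinarith
  calc v * (e * (e ^ 2 + 2 * ρ * t)) ≤ v * (e * (e ^ 2 + 2 * t)) := by gcongr
    _ = e * (v * (e ^ 2 + 2 * t)) := by ring
    _ ≤ e * (3 * (t * e ^ 2)) := by gcongr
    _ = 3 / 4 * (t * (4 * e ^ 3)) := by ring
    _ ≤ ρ * (1 + ρ) * (t * (4 * e ^ 3)) := by gcongr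
    _ = _ := by ring

/-- The logarithm of `genProd` on the unit disc. -/
noncomputable def genLog (r : ℕ) (b₁ b₂ : Fin (r + 1) → ℝ) (k : Fin (r + 1) → ℕ) (z : ℂ) : ℂ :=
  ∑ j : Fin (r + 1),
    ((b₁ j : ℂ) * -Complex.log (1 - z ^ (2 * k j)) + (b₂ j : ℂ) * (1 / (1 - z ^ k j)))

/-- The logarithm of `genProd` on the real segment `(-1, 1)`. -/
noncomputable def genLogReal (r : ℕ) (b₁ b₂ : Fin (r + 1) → ℝ) (k : Fin (r + 1) → ℕ) (ρ : ℝ) : ℝ :=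
  ∑ j : Fin (r + 1),
    (b₁ j * -Real.log (1 - ρ ^ (2 * k j)) + b₂ j * (1 / (1 - ρ ^ k j)))

theorem one_sub_pow_mem_slitPlane {z : ℂ} (hz : ‖z‖ < 1) {n : ℕ} (hn : n ≠ 0) :
    1 - z ^ n ∈ Complex.slitPlane := by
  have h : ‖z ^ n‖ < 1 := by
    rw [norm_pow]; exact pow_lt_one₀ (norm_nonneg z) hz hn
  left
  have := Complex.re_le_norm (z ^ n)
  rw [Complex.sub_re, Complex.one_re]
  linarith

section
variable {r : ℕ} {b₁ b₂ : Fin (r + 1) → ℝ} {k : Fin (r + 1) → ℕ}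

theorem genProd_eq_exp_genLog (hk : ∀ j, 0 < k j) {z : ℂ} (hz : ‖z‖ < 1) :
    genProd r b₁ b₂ k z = Complex.exp (genLog r b₁ b₂ k z) := by
  rw [genProd, genLog, Complex.exp_sum]
  refine Finset.prod_congr rfl fun j _ => ?_
  have h := Complex.slitPlane_ne_zero (one_sub_pow_mem_slitPlane hz
    (mul_pos two_pos (hk j)).ne')
  rw [Complex.cpow_def_of_ne_zero h, ← Complex.exp_add]
  congr 1
  ring

theorem genLog_ofReal (hk : ∀ j, 0 < k j) {ρ : ℝ} (hρ : |ρ| < 1) :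
    genLog r b₁ b₂ k ρ = (genLogReal r b₁ b₂ k ρ : ℂ) := by
  rw [genLog, genLogReal, Complex.ofReal_sum]
  refine Finset.sum_congr rfl fun j _ => ?_
  have h : |ρ ^ (2 * k j)| < 1 := by
    rw [abs_pow]; exact pow_lt_one₀ (abs_nonneg _) hρ (mul_pos two_pos (hk j)).ne'
  have h' := (abs_lt.1 h).2
  push_cast [Complex.ofReal_log (by linarith : 0 ≤ 1 - ρ ^ (2 * k j))]
  rfl

theorem genProd_ofReal (hk : ∀ j, 0 < k j) {ρ : ℝ} (hρ : |ρ| < 1) :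
    genProd r b₁ b₂ k ρ = (Real.exp (genLogReal r b₁ b₂ k ρ) : ℂ) := by
  rw [genProd_eq_exp_genLog hk (by rwa [Complex.norm_real]), genLog_ofReal hk hρ,
    Complex.ofReal_exp]

theorem differentiableOn_genProd (hk : ∀ j, 0 < k j) :
    DifferentiableOn ℂ (genProd r b₁ b₂ k) (Metric.ball 0 1) := by
  refine DifferentiableOn.congr (f := fun z => Complex.exp (genLog r b₁ b₂ k z)) ?_
    fun z hz => genProd_eq_exp_genLog hk (by simpa using hz)
  intro z hz
  have hz1 : ‖z‖ < 1 := by simpa using hz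
  refine DifferentiableAt.differentiableWithinAt ?_
  refine DifferentiableAt.cexp ?_
  unfold genLog
  refine DifferentiableAt.fun_sum fun j _ => ?_
  have h1 := one_sub_pow_mem_slitPlane hz1 (mul_pos two_pos (hk j)).ne'
  have h2 := Complex.slitPlane_ne_zero (one_sub_pow_mem_slitPlane hz1 (hk j).ne')
  have d : ∀ n : ℕ, DifferentiableAt ℂ (fun z : ℂ => 1 - z ^ n) z := fun n => by fun_prop
  exact (((d _).clog h1).neg.const_mul _).add
    (((differentiableAt_const (1 : ℂ)).div (d _) h2).const_mul _)

theorem exists_hasDerivAt_genLogReal (hk : ∀ j, 0 < k j) {ρ : ℝ} (hρ : |ρ| < 1) :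
    ∃ D : ℝ, HasDerivAt (genLogReal r b₁ b₂ k) D ρ ∧ ρ * D = explicitA r b₁ b₂ k ρ := by
  have hlt : ∀ n : ℕ, 0 < n → 1 - ρ ^ n ≠ 0 := by
    intro n hn
    have h : |ρ ^ n| < 1 := by rw [abs_pow]; exact pow_lt_one₀ (abs_nonneg _) hρ hn.ne'
    have := (abs_lt.1 h).2
    linarith
  refine ⟨∑ j, (b₁ j * -(-((2 * k j : ℕ) * ρ ^ (2 * k j - 1)) / (1 - ρ ^ (2 * k j))) +
    b₂ j * (-(-(k j * ρ ^ (k j - 1))) / (1 - ρ ^ k j) ^ 2)), ?_, ?_⟩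
  · unfold genLogReal
    refine HasDerivAt.fun_sum fun j _ => ?_
    have h1 := ((hasDerivAt_pow (2 * k j) ρ).const_sub 1).log (hlt _ (mul_pos two_pos (hk j)))
    have h2 := ((hasDerivAt_pow (k j) ρ).const_sub 1).fun_inv (hlt _ (hk j))
    simp only [one_div]
    exact (h1.neg.const_mul _).add (h2.const_mul _)
  · rw [explicitA, Finset.mul_sum]
    refine Finset.sum_congr rfl fun j _ => ?_
    have e1 := mul_pow_sub_one (mul_pos two_pos (hk j)).ne' ρ
    have e2 := mul_pow_sub_one (hk j).ne' ρ
    rw [← e1, ← e2]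
    push_cast
    ring

theorem haymanA_genProd (hk : ∀ j, 0 < k j) {ρ : ℝ} (hρ : |ρ| < 1) :
    haymanA (genProd r b₁ b₂ k) ρ = explicitA r b₁ b₂ k ρ := by
  obtain ⟨D, hD, hA⟩ := exists_hasDerivAt_genLogReal (b₁ := b₁) (b₂ := b₂) hk hρ
  have hev : (fun t : ℝ => genProd r b₁ b₂ k t) =ᶠ[nhds ρ]
      fun t => ((Real.exp (genLogReal r b₁ b₂ k t) : ℝ) : ℂ) := by
    filter_upwards [(isOpen_lt continuous_abs continuous_const).mem_nhds hρ] with t ht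
    exact genProd_ofReal hk ht
  rw [haymanA, hev.deriv_eq, hD.exp.ofReal_comp.deriv, genProd_ofReal hk hρ, ← hA]
  have h0 : (Real.exp (genLogReal r b₁ b₂ k ρ) : ℂ) ≠ 0 := by
    exact_mod_cast (Real.exp_pos _).ne'
  have : (ρ : ℂ) * (1 / (Real.exp (genLogReal r b₁ b₂ k ρ) : ℂ)) *
      ((Real.exp (genLogReal r b₁ b₂ k ρ) * D : ℝ) : ℂ) = ((ρ * D : ℝ) : ℂ) := by
    rw [Complex.ofReal_mul]
    push_cast at h0 ⊢
    field_simp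
  rw [this, Complex.ofReal_re]

theorem exists_hasDerivAt_explicitA (hk : ∀ j, 0 < k j) {ρ : ℝ} (hρ : |ρ| < 1) :
    ∃ D : ℝ, HasDerivAt (explicitA r b₁ b₂ k) D ρ ∧ ρ * D = explicitB r b₁ b₂ k ρ := by
  have hlt : ∀ n : ℕ, 0 < n → 1 - ρ ^ n ≠ 0 := by
    intro n hn
    have h : |ρ ^ n| < 1 := by rw [abs_pow]; exact pow_lt_one₀ (abs_nonneg _) hρ hn.ne'
    have := (abs_lt.1 h).2
    linarith
  have hterm : ∀ j, ∃ D : ℝ, HasDerivAt (fun ρ : ℝ => b₁ j * (2 * (k j : ℝ)) *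
      (ρ ^ (2 * k j) / (1 - ρ ^ (2 * k j))) + b₂ j * (k j : ℝ) * (ρ ^ k j / (1 - ρ ^ k j) ^ 2)) D ρ ∧
      ρ * D = 4 * b₁ j * (k j : ℝ) ^ 2 *
        (ρ ^ (2 * k j) / (1 - ρ ^ (2 * k j)) + (ρ ^ (2 * k j) / (1 - ρ ^ (2 * k j))) ^ 2)
      + b₂ j * (k j : ℝ) ^ 2 *
        (ρ ^ k j / (1 - ρ ^ k j) ^ 2 + 2 * (ρ ^ (2 * k j) / (1 - ρ ^ k j) ^ 3)) := by
    intro j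
    have n1 := hlt _ (mul_pos two_pos (hk j))
    have n2 := hlt _ (hk j)
    have p1 := hasDerivAt_pow (2 * k j) ρ
    have p2 := hasDerivAt_pow (k j) ρ
    have h1 := (p1.fun_div (p1.const_sub 1) n1).const_mul (b₁ j * (2 * (k j : ℝ)))
    have h2 := (p2.fun_div ((p2.const_sub 1).fun_pow 2) (pow_ne_zero 2 n2)).const_mul
      (b₂ j * (k j : ℝ))
    refine ⟨_, h1.add h2, ?_⟩
    have e1 := mul_pow_sub_one (mul_pos two_pos (hk j)).ne' ρ
    have e2 := mul_pow_sub_one (hk j).ne' ρ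
    have e3 : ρ ^ (2 * k j) = (ρ ^ k j) ^ 2 := by rw [← pow_mul, mul_comm]
    have t1 : ∀ u X N : ℝ, ρ * u = X → 1 - X ≠ 0 →
        ρ * ((N * u * (1 - X) - X * -(N * u)) / (1 - X) ^ 2) =
          N * (X / (1 - X) + (X / (1 - X)) ^ 2) := by
      rintro u X N rfl h
      field_simp
      ring
    have t2 : ∀ v x N : ℝ, ρ * v = x → 1 - x ≠ 0 →
        ρ * ((N * v * (1 - x) ^ 2 - x * ((2 : ℕ) * (1 - x) ^ (2 - 1) * -(N * v))) /
            ((1 - x) ^ 2) ^ 2) =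
          N * (x / (1 - x) ^ 2 + 2 * (x ^ 2 / (1 - x) ^ 3)) := by
      rintro v x N rfl h
      push_cast
      field_simp
      ring
    have s1 := t1 _ _ (2 * k j : ℕ) e1 n1
    have s2 := t2 _ _ (k j) e2 n2
    rw [← e3] at s2
    rw [mul_add, mul_left_comm ρ, s1, mul_left_comm ρ, s2]
    push_cast
    ring
  choose D hD hB using hterm
  refine ⟨∑ j, D j, ?_, ?_⟩
  · unfold explicitA
    exact HasDerivAt.fun_sum fun j _ => hD j
  · rw [explicitB, Finset.mul_sum]
    exact Finset.sum_congr rfl fun j _ => hB j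

theorem haymanB_genProd (hk : ∀ j, 0 < k j) {ρ : ℝ} (hρ : |ρ| < 1) :
    haymanB (genProd r b₁ b₂ k) ρ = explicitB r b₁ b₂ k ρ := by
  obtain ⟨D, hD, hB⟩ := exists_hasDerivAt_explicitA (b₁ := b₁) (b₂ := b₂) hk hρ
  have hev : haymanA (genProd r b₁ b₂ k) =ᶠ[nhds ρ] explicitA r b₁ b₂ k := by
    filter_upwards [(isOpen_lt continuous_abs continuous_const).mem_nhds hρ] with t ht
    exact haymanA_genProd hk ht
  rw [haymanB, hev.deriv_eq, hD.deriv, hB]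

theorem pow_mul_exp_I (ρ θ : ℝ) (n : ℕ) :
    ((ρ : ℂ) * Complex.exp (Complex.I * θ)) ^ n =
      ((ρ ^ n : ℝ) : ℂ) * Complex.exp (Complex.I * (n * θ : ℝ)) := by
  rw [mul_pow, ← Complex.exp_nat_mul, Complex.ofReal_pow]
  congr 2
  push_cast; ring

theorem norm_genLog_angle_expansion_le (hb₁ : ∀ j, 0 ≤ b₁ j) (hb₂ : ∀ j, 0 ≤ b₂ j)
    (hk : ∀ j, 0 < k j) {ρ : ℝ} (hρ0 : 0 ≤ ρ) (hρ1 : ρ < 1) (θ : ℝ) :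
    ‖genLog r b₁ b₂ k (ρ * Complex.exp (Complex.I * θ)) - (genLogReal r b₁ b₂ k ρ : ℂ) -
        Complex.I * θ * (explicitA r b₁ b₂ k ρ : ℂ) +
        (θ : ℂ) ^ 2 / 2 * (explicitB r b₁ b₂ k ρ : ℂ)‖ ≤
      (∑ j, (b₁ j * (24 * (2 * k j) ^ 3) + b₂ j * (24 * (k j : ℝ) ^ 3))) *
        (|θ| ^ 3 / (1 - ρ) ^ 4) := by
  rw [genLog, genLogReal, explicitA, explicitB]
  push_cast only [Complex.ofReal_sum]
  rw [Finset.mul_sum, Finset.mul_sum, ← Finset.sum_sub_distrib, ← Finset.sum_sub_distrib,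
    ← Finset.sum_add_distrib, Finset.sum_mul]
  refine norm_sum_le_of_le _ fun j _ => ?_
  have hpow : ∀ n : ℕ, 0 < n → 0 ≤ ρ ^ n ∧ ρ ^ n < 1 ∧ 1 - ρ ≤ 1 - ρ ^ n := by
    intro n hn
    exact ⟨pow_nonneg hρ0 n, pow_lt_one₀ hρ0 hρ1 hn.ne',
      sub_le_sub_left (pow_le_of_le_one hρ0 hρ1.le hn.ne') 1⟩
  obtain ⟨u0, u1, u2⟩ := hpow (2 * k j) (mul_pos two_pos (hk j))
  obtain ⟨v0, v1, v2⟩ := hpow (k j) (hk j)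
  have h1 := norm_neg_log_one_sub_expansion_le u0 u1 ((2 * k j : ℕ) * θ)
  have h2 := norm_one_div_one_sub_expansion_le v0 v1 (k j * θ)
  rw [← pow_mul_exp_I] at h1 h2
  have hρe : 0 < 1 - ρ := by linarith
  have hb : ∀ (n : ℕ) (x : ℝ), 1 - ρ ≤ 1 - x →
      24 * |(n : ℝ) * θ| ^ 3 / (1 - x) ^ 4 ≤ 24 * (n : ℝ) ^ 3 * (|θ| ^ 3 / (1 - ρ) ^ 4) := by
    intro n x hx
    rw [abs_mul, Nat.abs_cast, mul_pow, ← mul_assoc, mul_div_assoc]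
    gcongr
  replace h1 := h1.trans (hb _ _ u2)
  replace h2 := h2.trans (hb _ _ v2)
  have hsq : ρ ^ (2 * k j) = (ρ ^ k j) ^ 2 := by rw [← pow_mul, mul_comm]
  have h := norm_add_le_of_le
    ((norm_mul_le (b₁ j : ℂ) _).trans (mul_le_mul_of_nonneg_left h1 (norm_nonneg _)))
    ((norm_mul_le (b₂ j : ℂ) _).trans (mul_le_mul_of_nonneg_left h2 (norm_nonneg _)))
  rw [Complex.norm_real, Complex.norm_real, Real.norm_of_nonneg (hb₁ j),
    Real.norm_of_nonneg (hb₂ j)] at h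
  refine (le_of_eq ?_).trans (h.trans (le_of_eq ?_))
  · congr 1
    rw [← hsq]
    push_cast
    ring
  · push_cast; ring

theorem re_genLog_sub_genLogReal_le (hb₁ : ∀ j, 0 ≤ b₁ j) (hb₂ : ∀ j, 0 ≤ b₂ j)
    (hk : ∀ j, 0 < k j) {z : ℂ} (hz : ‖z‖ < 1) (i : Fin (r + 1)) :
    (genLog r b₁ b₂ k z).re ≤ genLogReal r b₁ b₂ k ‖z‖ -
      b₂ i * (1 / (1 - ‖z‖ ^ k i) - (1 / (1 - z ^ k i)).re) := by
  have hpow : ∀ n : ℕ, 0 < n → 0 < 1 - ‖z‖ ^ n ∧ 1 - ‖z‖ ^ n ≤ ‖1 - z ^ n‖ := by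
    intro n hn
    refine ⟨sub_pos.2 (pow_lt_one₀ (norm_nonneg z) hz hn.ne'), ?_⟩
    have := norm_sub_norm_le (1 : ℂ) (z ^ n)
    rwa [norm_one, norm_pow] at this
  have hlog : ∀ j, 0 ≤ b₁ j * -Real.log (1 - ‖z‖ ^ (2 * k j)) -
      b₁ j * -(Complex.log (1 - z ^ (2 * k j))).re := by
    intro j
    obtain ⟨h0, h1⟩ := hpow (2 * k j) (mul_pos two_pos (hk j))
    rw [Complex.log_re, ← mul_sub]
    exact mul_nonneg (hb₁ j) (by linarith [Real.log_le_log h0 h1])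
  have hinv : ∀ j, 0 ≤ b₂ j * (1 / (1 - ‖z‖ ^ k j) - (1 / (1 - z ^ k j)).re) := by
    intro j
    obtain ⟨h0, h1⟩ := hpow (k j) (hk j)
    refine mul_nonneg (hb₂ j) (sub_nonneg.2 ((Complex.re_le_norm _).trans ?_))
    rw [norm_div, norm_one]
    exact one_div_le_one_div_of_le h0 h1
  have hdiff : genLogReal r b₁ b₂ k ‖z‖ - (genLog r b₁ b₂ k z).re =
      ∑ j, ((b₁ j * -Real.log (1 - ‖z‖ ^ (2 * k j)) -
        b₁ j * -(Complex.log (1 - z ^ (2 * k j))).re) +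
        b₂ j * (1 / (1 - ‖z‖ ^ k j) - (1 / (1 - z ^ k j)).re)) := by
    rw [genLogReal, genLog, Complex.re_sum, ← Finset.sum_sub_distrib]
    refine Finset.sum_congr rfl fun j _ => ?_
    rw [Complex.add_re, Complex.re_ofReal_mul, Complex.re_ofReal_mul, Complex.neg_re]
    ring
  have hsingle := Finset.single_le_sum
    (f := fun j => (b₁ j * -Real.log (1 - ‖z‖ ^ (2 * k j)) -
        b₁ j * -(Complex.log (1 - z ^ (2 * k j))).re) +
        b₂ j * (1 / (1 - ‖z‖ ^ k j) - (1 / (1 - z ^ k j)).re))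
    (fun j _ => add_nonneg (hlog j) (hinv j)) (Finset.mem_univ i)
  have := hlog i
  rw [← hdiff] at hsingle
  linarith

theorem explicitB_le (hb₁ : ∀ j, 0 ≤ b₁ j) (hb₂ : ∀ j, 0 ≤ b₂ j) (hk : ∀ j, 0 < k j) {ρ : ℝ}
    (hρ0 : 0 ≤ ρ) (hρ1 : ρ < 1) :
    explicitB r b₁ b₂ k ρ ≤
      (∑ j, (4 * b₁ j * (k j : ℝ) ^ 2 * 2 + b₂ j * (k j : ℝ) ^ 2 * 3)) / (1 - ρ) ^ 3 := by
  rw [explicitB, Finset.sum_div]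
  refine Finset.sum_le_sum fun j _ => ?_
  have he : 0 < 1 - ρ := by linarith
  have hq : ∀ (n m l : ℕ), 0 < n → m ≤ 3 → ρ ^ l / (1 - ρ ^ n) ^ m ≤ 1 / (1 - ρ) ^ 3 := by
    intro n m l hn hm
    have h1 : 1 - ρ ≤ 1 - ρ ^ n := sub_le_sub_left (pow_le_of_le_one hρ0 hρ1.le hn.ne') 1
    have h2 : (1 - ρ) ^ 3 ≤ (1 - ρ ^ n) ^ m :=
      (pow_le_pow_of_le_one he.le (by linarith) hm).trans (pow_le_pow_left₀ he.le h1 m)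
    exact div_le_div₀ zero_le_one (pow_le_one₀ hρ0 hρ1.le) (by positivity) h2
  have h2k := mul_pos two_pos (hk j)
  have q1 := hq (2 * k j) 1 (2 * k j) h2k (by norm_num)
  have q2 := hq (2 * k j) 2 (2 * k j * 2) h2k (by norm_num)
  have q3 := hq (k j) 2 (k j) (hk j) (by norm_num)
  have q4 := hq (k j) 3 (2 * k j) (hk j) le_rfl
  rw [pow_one] at q1
  rw [pow_mul, ← div_pow] at q2
  have hb1 := hb₁ j
  have hb2 := hb₂ j
  calc _ ≤ 4 * b₁ j * (k j : ℝ) ^ 2 * (1 / (1 - ρ) ^ 3 + 1 / (1 - ρ) ^ 3) +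
        b₂ j * (k j : ℝ) ^ 2 * (1 / (1 - ρ) ^ 3 + 2 * (1 / (1 - ρ) ^ 3)) := by gcongr
    _ = _ := by ring

theorem le_explicitB (hb₁ : ∀ j, 0 ≤ b₁ j) (hb₂ : ∀ j, 0 ≤ b₂ j) (hk : ∀ j, 0 < k j)
    {i : Fin (r + 1)} (hi : k i = 1) {ρ : ℝ} (hρ0 : 1 / 2 ≤ ρ) (hρ1 : ρ < 1) :
    b₂ i / 2 * (1 / (1 - ρ) ^ 3) ≤ explicitB r b₁ b₂ k ρ := by
  have hρ : 0 ≤ ρ := by linarith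
  have he : 0 < 1 - ρ := by linarith
  have hp : ∀ n, 0 < n → 0 < 1 - ρ ^ n := fun n hn => sub_pos.2 (pow_lt_one₀ hρ hρ1 hn.ne')
  have hnn : ∀ j, 0 ≤ 4 * b₁ j * (k j : ℝ) ^ 2 *
        (ρ ^ (2 * k j) / (1 - ρ ^ (2 * k j)) + (ρ ^ (2 * k j) / (1 - ρ ^ (2 * k j))) ^ 2) := by
    intro j
    have := hp _ (mul_pos two_pos (hk j))
    have := hb₁ j
    positivity
  have hnn' : ∀ j, 0 ≤ b₂ j * (k j : ℝ) ^ 2 *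
        (ρ ^ k j / (1 - ρ ^ k j) ^ 2 + 2 * (ρ ^ (2 * k j) / (1 - ρ ^ k j) ^ 3)) := by
    intro j
    have := hp _ (hk j)
    have := hb₂ j
    positivity
  refine le_trans ?_ (Finset.single_le_sum
    (fun j _ => add_nonneg (hnn j) (hnn' j)) (Finset.mem_univ i))
  refine le_trans ?_ (le_add_of_nonneg_left (hnn i))
  rw [hi, Nat.cast_one, one_pow, mul_one, pow_one, mul_one]
  have h1 : 1 / 2 * (1 / (1 - ρ) ^ 3) ≤ 2 * (ρ ^ 2 / (1 - ρ) ^ 3) := by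
    rw [mul_div_assoc', mul_div_assoc']
    exact div_le_div_of_nonneg_right (by nlinarith) (by positivity)
  have h2 : 0 ≤ ρ / (1 - ρ) ^ 2 := by positivity
  have := mul_le_mul_of_nonneg_left (h1.trans (le_add_of_nonneg_left h2)) (hb₂ i)
  calc _ = b₂ i * (1 / 2 * (1 / (1 - ρ) ^ 3)) := by ring
    _ ≤ _ := this

end

/-- The splitting angle `(1 - ρ) ^ (7 / 5)`. -/
noncomputable def splitAngle (ρ : ℝ) : ℝ :=
  if ρ = 1 then 1 else ((1 - ρ) ^ (1 / 5 : ℝ)) ^ 7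

theorem splitAngle_mem {ρ : ℝ} (h : ρ ∈ Set.Icc (0 : ℝ) 1) :
    0 < splitAngle ρ ∧ splitAngle ρ < Real.pi := by
  have hpi := Real.pi_gt_three
  rw [splitAngle]
  split_ifs with h1
  · exact ⟨one_pos, by linarith⟩
  · have hlt : 0 < 1 - ρ := sub_pos.2 (lt_of_le_of_ne h.2 h1)
    have hs0 : 0 < (1 - ρ) ^ (1 / 5 : ℝ) := Real.rpow_pos_of_pos hlt _
    have hs1 : (1 - ρ) ^ (1 / 5 : ℝ) ≤ 1 :=
      Real.rpow_le_one hlt.le (by linarith [h.1]) (by norm_num)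
    exact ⟨by positivity, lt_of_le_of_lt (pow_le_one₀ hs0.le hs1) (by linarith)⟩

theorem tendsto_one_sub_rpow :
    Filter.Tendsto (fun ρ : ℝ => (1 - ρ) ^ (1 / 5 : ℝ)) (nhdsWithin 1 (Set.Iio 1))
      (nhdsWithin 0 (Set.Ioi 0)) := by
  refine tendsto_nhdsWithin_iff.2 ⟨?_, ?_⟩
  · have hc : ContinuousAt (fun ρ : ℝ => (1 - ρ) ^ (1 / 5 : ℝ)) 1 :=
      (continuousAt_const.sub continuousAt_id).rpow_const (Or.inr (by norm_num))
    have := hc.tendsto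
    rw [sub_self, Real.zero_rpow (by norm_num)] at this
    exact this.mono_left nhdsWithin_le_nhds
  · filter_upwards [self_mem_nhdsWithin] with ρ hρ
    exact Real.rpow_pos_of_pos (sub_pos.2 hρ) _

theorem one_sub_rpow_pow {ρ : ℝ} (hρ : ρ < 1) : ((1 - ρ) ^ (1 / 5 : ℝ)) ^ 5 = 1 - ρ := by
  rw [← Real.rpow_natCast, ← Real.rpow_mul (sub_nonneg.2 hρ.le)]
  norm_num

theorem isHAdmissible_genProd {r : ℕ} {b₁ b₂ : Fin (r + 1) → ℝ} {k : Fin (r + 1) → ℕ}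
    (hb₁ : ∀ j, 0 ≤ b₁ j) (hb₂ : ∀ j, 0 ≤ b₂ j) (hk : ∀ j, 0 < k j) {i : Fin (r + 1)}
    (hi : k i = 1) (hbi : 0 < b₂ i) : IsHAdmissible 1 (genProd r b₁ b₂ k) := by
  have hnear : ∀ᶠ ρ : ℝ in nhdsWithin 1 (Set.Iio 1), 1 / 2 < ρ ∧ ρ < 1 :=
    ((lt_mem_nhds (by norm_num : (1 / 2 : ℝ) < 1)).filter_mono nhdsWithin_le_nhds).and
      self_mem_nhdsWithin
  have habs : ∀ {ρ : ℝ}, 1 / 2 < ρ → ρ < 1 → |ρ| < 1 := fun h h' =>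
    abs_lt.2 ⟨by linarith, h'⟩
  have hnorm : ∀ {ρ : ℝ} (θ : ℝ), 1 / 2 < ρ →
      ‖(ρ : ℂ) * Complex.exp (Complex.I * θ)‖ = ρ := by
    intro ρ θ h
    rw [norm_mul, Complex.norm_exp_I_mul_ofReal, mul_one, Complex.norm_real,
      Real.norm_of_nonneg (by linarith)]
  refine ⟨one_pos, differentiableOn_genProd hk, ?_, splitAngle, fun ρ => splitAngle_mem,
    ?_, ?_, ?_⟩
  · filter_upwards [hnear] with ρ ⟨h1, h2⟩
    rw [genProd_ofReal hk (habs h1 h2), Complex.ofReal_im, Complex.ofReal_re]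
    exact ⟨rfl, Real.exp_pos _⟩
  · intro ε hε
    set K := ∑ j, (b₁ j * (24 * (2 * k j) ^ 3) + b₂ j * (24 * (k j : ℝ) ^ 3)) with hK
    have hK0 : 0 ≤ K := Finset.sum_nonneg fun j _ => by
      have := hb₁ j
      have := hb₂ j
      positivity
    have hsmall := ((tendsto_one_sub_rpow.mono_right nhdsWithin_le_nhds).const_mul
      K).eventually (gt_mem_nhds (by rw [mul_zero]; positivity : K * 0 < min 1 (ε / 2)))
    filter_upwards [hnear, hsmall] with ρ ⟨h1, h2⟩ hs θ hθ
    have hρ := habs h1 h2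
    set s := (1 - ρ) ^ (1 / 5 : ℝ) with hsdef
    have hs0 : 0 < s := Real.rpow_pos_of_pos (sub_pos.2 h2) _
    have hs5 : s ^ 5 = 1 - ρ := one_sub_rpow_pow h2
    rw [splitAngle, if_neg h2.ne, ← hsdef] at hθ
    rw [haymanA_genProd hk hρ, haymanB_genProd hk hρ]
    have hexp := norm_genLog_angle_expansion_le hb₁ hb₂ hk (by linarith) h2 θ
    rw [← hK, ← hs5] at hexp
    set A := explicitA r b₁ b₂ k ρ
    set B := explicitB r b₁ b₂ k ρ
    set E := genLog r b₁ b₂ k (ρ * Complex.exp (Complex.I * θ)) -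
      (genLogReal r b₁ b₂ k ρ : ℂ) - Complex.I * θ * (A : ℂ) + (θ : ℂ) ^ 2 / 2 * (B : ℂ) with hE
    have hEle : ‖E‖ ≤ K * s := by
      refine hexp.trans (mul_le_mul_of_nonneg_left ?_ hK0)
      rw [div_le_iff₀ (by positivity)]
      calc |θ| ^ 3 ≤ (s ^ 7) ^ 3 := by gcongr
        _ = s * (s ^ 5) ^ 4 := by ring
    have hE1 : ‖E‖ ≤ 1 := hEle.trans (hs.le.trans (min_le_left _ _))
    have hE2 : ‖E‖ ≤ ε / 2 := hEle.trans (hs.le.trans (min_le_right _ _))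
    set M := genProd r b₁ b₂ k ρ * Complex.exp (Complex.I * θ * A - (1 / 2 : ℂ) * θ ^ 2 * B)
      with hM
    have hprod : genProd r b₁ b₂ k (ρ * Complex.exp (Complex.I * θ)) = M * Complex.exp E := by
      rw [hM, genProd_eq_exp_genLog hk (by rw [hnorm θ h1]; exact h2), genProd_ofReal hk hρ,
        Complex.ofReal_exp, ← Complex.exp_add, ← Complex.exp_add, hE]
      congr 1
      ring
    rw [hprod, show M * Complex.exp E - M = (Complex.exp E - 1) * M by ring, norm_mul]
    gcongr
    exact (Complex.norm_exp_sub_one_le hE1).trans (by linarith)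
  · intro ε hε
    set K := ∑ j, (4 * b₁ j * (k j : ℝ) ^ 2 * 2 + b₂ j * (k j : ℝ) ^ 2 * 3) with hK
    have hK0 : 0 ≤ K := Finset.sum_nonneg fun j _ => by
      have := hb₁ j
      have := hb₂ j
      positivity
    have hdecay : Filter.Tendsto (fun ρ : ℝ => Real.sqrt K *
        ((((1 - ρ) ^ (1 / 5 : ℝ))⁻¹) ^ (8 : ℝ) *
          Real.exp (-(b₂ i / 20) * ((1 - ρ) ^ (1 / 5 : ℝ))⁻¹)))
        (nhdsWithin 1 (Set.Iio 1)) (nhds (Real.sqrt K * 0)) :=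
      ((tendsto_rpow_mul_exp_neg_mul_atTop_nhds_zero 8 (b₂ i / 20) (by positivity)).comp
        (tendsto_inv_nhdsGT_zero.comp tendsto_one_sub_rpow)).const_mul _
    filter_upwards [hnear, hdecay.eventually (gt_mem_nhds (by rwa [mul_zero]))] with
      ρ ⟨h1, h2⟩ hs θ hθ hθπ
    have hρ := habs h1 h2
    set s := (1 - ρ) ^ (1 / 5 : ℝ) with hsdef
    have hs0 : 0 < s := Real.rpow_pos_of_pos (sub_pos.2 h2) _
    have hs1 : s ≤ 1 := Real.rpow_le_one (sub_pos.2 h2).le (by linarith) (by norm_num)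
    have hs5 : s ^ 5 = 1 - ρ := one_sub_rpow_pow h2
    rw [splitAngle, if_neg h2.ne, ← hsdef] at hθ
    rw [haymanB_genProd hk hρ]
    have hcos : (s ^ 7) ^ 2 / 5 ≤ 1 - Real.cos θ := by
      have hc := Real.cos_le_one_sub_mul_cos_sq hθπ
      have hsq : (s ^ 7) ^ 2 ≤ θ ^ 2 := by
        rw [← sq_abs θ]; exact pow_le_pow_left₀ (by positivity) hθ 2
      have hπ : 1 / 5 ≤ 2 / Real.pi ^ 2 := by
        rw [div_le_div_iff₀ (by norm_num) (by positivity)]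
        nlinarith [Real.pi_lt_d2, Real.pi_pos]
      have := mul_le_mul hπ hsq (by positivity) (by positivity)
      linarith
    have hgap := le_one_div_sub_re_one_div_one_sub h1.le h2 (by positivity) (by
      rw [← hs5]
      have : s ^ 4 ≤ 1 := pow_le_one₀ hs0.le hs1
      have h10 : 0 ≤ s ^ 10 := by positivity
      nlinarith) hcos
    rw [← hs5, show (s ^ 7) ^ 2 / 5 / (4 * (s ^ 5) ^ 3) = s⁻¹ / 20 by field_simp; norm_num,
      hs5] at hgap
    have hre := re_genLog_sub_genLogReal_le hb₁ hb₂ hk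
      (z := ρ * Complex.exp (Complex.I * θ)) (by rwa [hnorm θ h1]) i
    rw [hnorm θ h1, hi, pow_one, pow_one] at hre
    have hFz : ‖genProd r b₁ b₂ k (ρ * Complex.exp (Complex.I * θ))‖ ≤
        ‖genProd r b₁ b₂ k ρ‖ * Real.exp (-(b₂ i / 20) * s⁻¹) := by
      rw [genProd_eq_exp_genLog hk (by rwa [hnorm θ h1]), genProd_ofReal hk hρ,
        Complex.norm_exp, Complex.norm_real, Real.norm_of_nonneg (Real.exp_pos _).le,
        ← Real.exp_add]
      apply Real.exp_le_exp.2
      have := mul_le_mul_of_nonneg_left hgap hbi.le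
      linarith
    have hBpos : 0 < explicitB r b₁ b₂ k ρ :=
      lt_of_lt_of_le (by positivity) (le_explicitB hb₁ hb₂ hk hi h1.le h2)
    have hB0 := Real.sqrt_pos.2 hBpos
    have hB : Real.sqrt (explicitB r b₁ b₂ k ρ) ≤ Real.sqrt K * (s⁻¹) ^ 8 := by
      have hub := explicitB_le hb₁ hb₂ hk (by linarith) h2
      rw [← hK, ← hs5] at hub
      refine Real.sqrt_le_iff.2 ⟨by positivity, hub.trans ?_⟩
      rw [mul_pow, Real.sq_sqrt hK0, div_eq_mul_inv]
      refine mul_le_mul_of_nonneg_left ?_ hK0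
      rw [← pow_mul, ← pow_mul, ← inv_pow]
      exact pow_le_pow_right₀ ((one_le_inv₀ hs0).2 hs1) (by norm_num)
    rw [show (8 : ℝ) = ((8 : ℕ) : ℝ) by norm_num, Real.rpow_natCast] at hs
    refine hFz.trans ?_
    rw [mul_div_assoc', le_div_iff₀ hB0]
    calc _ = ‖genProd r b₁ b₂ k ρ‖ * (Real.sqrt (explicitB r b₁ b₂ k ρ) *
          Real.exp (-(b₂ i / 20) * s⁻¹)) := by ring
      _ ≤ ‖genProd r b₁ b₂ k ρ‖ * (Real.sqrt K * (s⁻¹) ^ 8 *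
          Real.exp (-(b₂ i / 20) * s⁻¹)) := by gcongr
      _ ≤ ‖genProd r b₁ b₂ k ρ‖ * ε := by
          gcongr
          rw [mul_assoc]
          exact hs.le
      _ = _ := mul_comm _ _
  · have hlim : Filter.Tendsto (fun ρ : ℝ => b₂ i / 2 * (((1 - ρ) ^ (1 / 5 : ℝ))⁻¹) ^ 15)
        (nhdsWithin 1 (Set.Iio 1)) Filter.atTop :=
      ((Filter.tendsto_pow_atTop (by norm_num)).comp
        (tendsto_inv_nhdsGT_zero.comp tendsto_one_sub_rpow)).const_mul_atTop (by positivity)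
    refine Filter.tendsto_atTop_mono' _ ?_ hlim
    filter_upwards [hnear] with ρ ⟨h1, h2⟩
    rw [haymanB_genProd hk (habs h1 h2)]
    refine (le_of_eq ?_).trans (le_explicitB hb₁ hb₂ hk hi h1.le h2)
    have h3 : (1 - ρ) ^ 3 = ((1 - ρ) ^ (1 / 5 : ℝ)) ^ 15 := by
      rw [pow_mul _ 5 3, one_sub_rpow_pow h2]
    rw [h3, inv_pow, one_div (_ ^ 15)]

theorem proposition6p1 (r : ℕ) (hr : 1 ≤ r) (b₁ b₂ : Fin (r + 1) → ℝ) (k : Fin (r + 1) → ℕ)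
    (hb₁ : ∀ j, 0 < b₁ j) (hb₂ : ∀ j, 0 < b₂ j)
    (hk0 : k 0 = 1) (hk : ∀ j, j ≠ 0 → k 0 < k j) :
    -- the Taylor series converges to `F` on the unit disc
    (∀ z : ℂ, ‖z‖ < 1 →
      HasSum (fun n : ℕ => taylorCoeffZero (genProd r b₁ b₂ k) n * z ^ n)
        (genProd r b₁ b₂ k z)) ∧
    -- `F` is H-admissible, and its functions `A`, `B` are the explicit ones
    IsHAdmissible 1 (genProd r b₁ b₂ k) ∧
    (∀ ρ ∈ Set.Ico (0 : ℝ) 1,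
      haymanA (genProd r b₁ b₂ k) ρ = explicitA r b₁ b₂ k ρ ∧
      haymanB (genProd r b₁ b₂ k) ρ = explicitB r b₁ b₂ k ρ) ∧
    -- the Gaussian estimate, uniformly in all `n`
    (∀ ε : ℝ, 0 < ε → ∀ᶠ ρ : ℝ in nhdsWithin 1 (Set.Iio 1), ∀ n : ℕ,
      ‖taylorCoeffZero (genProd r b₁ b₂ k) n * (ρ : ℂ) ^ n
          - gaussPrefactor (genProd r b₁ b₂ k) (explicitB r b₁ b₂ k) ρ
            * (gaussFactor (explicitA r b₁ b₂ k) (explicitB r b₁ b₂ k) ρ n : ℂ)‖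
        ≤ ε * ‖gaussPrefactor (genProd r b₁ b₂ k) (explicitB r b₁ b₂ k) ρ‖) ∧
    -- the same with a relative error `1 + o(1)`, uniformly for `|A(ρ) - n| ≤ C √B(ρ)`
    (∀ C : ℝ, 0 < C → ∀ ε : ℝ, 0 < ε → ∀ᶠ ρ : ℝ in nhdsWithin 1 (Set.Iio 1), ∀ n : ℕ,
      |explicitA r b₁ b₂ k ρ - (n : ℝ)| ≤ C * Real.sqrt (explicitB r b₁ b₂ k ρ) →
      ‖taylorCoeffZero (genProd r b₁ b₂ k) n * (ρ : ℂ) ^ n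
          - gaussPrefactor (genProd r b₁ b₂ k) (explicitB r b₁ b₂ k) ρ
            * (gaussFactor (explicitA r b₁ b₂ k) (explicitB r b₁ b₂ k) ρ n : ℂ)‖
        ≤ ε * ‖gaussPrefactor (genProd r b₁ b₂ k) (explicitB r b₁ b₂ k) ρ
            * (gaussFactor (explicitA r b₁ b₂ k) (explicitB r b₁ b₂ k) ρ n : ℂ)‖) := by

  have hkpos : ∀ j, 0 < k j := by
    intro j
    rcases eq_or_ne j 0 with rfl | hj
    · rw [hk0]; exact one_pos
    · exact (Nat.zero_le _).trans_lt (hk j hj)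
  have hadm : IsHAdmissible 1 (genProd r b₁ b₂ k) :=
    isHAdmissible_genProd (fun j => (hb₁ j).le) (fun j => (hb₂ j).le) hkpos hk0 (hb₂ 0)
  have hAB : ∀ ρ ∈ Set.Ico (0 : ℝ) 1,
      haymanA (genProd r b₁ b₂ k) ρ = explicitA r b₁ b₂ k ρ ∧
      haymanB (genProd r b₁ b₂ k) ρ = explicitB r b₁ b₂ k ρ := by
    intro ρ hρ
    have habs : |ρ| < 1 := by rw [abs_of_nonneg hρ.1]; exact hρ.2
    exact ⟨haymanA_genProd hkpos habs, haymanB_genProd hkpos habs⟩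
  have hnear : ∀ᶠ ρ : ℝ in nhdsWithin 1 (Set.Iio 1), ρ ∈ Set.Ico (0 : ℝ) 1 :=
    ((lt_mem_nhds (by norm_num : (0 : ℝ) < 1)).filter_mono nhdsWithin_le_nhds).and
      self_mem_nhdsWithin |>.mono fun ρ h => ⟨h.1.le, h.2⟩
  have hgauss : ∀ ε : ℝ, 0 < ε → ∀ᶠ ρ : ℝ in nhdsWithin 1 (Set.Iio 1), ∀ n : ℕ,
      ‖taylorCoeffZero (genProd r b₁ b₂ k) n * (ρ : ℂ) ^ n
          - gaussPrefactor (genProd r b₁ b₂ k) (explicitB r b₁ b₂ k) ρ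
            * (gaussFactor (explicitA r b₁ b₂ k) (explicitB r b₁ b₂ k) ρ n : ℂ)‖
        ≤ ε * ‖gaussPrefactor (genProd r b₁ b₂ k) (explicitB r b₁ b₂ k) ρ‖ := by
    intro ε hε
    filter_upwards [hadm.taylorCoeffZero_gaussian hε, hnear] with ρ h hρ
    simpa only [gaussPrefactor, gaussFactor, hAB ρ hρ] using h
  have hBpos : ∀ᶠ ρ : ℝ in nhdsWithin 1 (Set.Iio 1), 0 < explicitB r b₁ b₂ k ρ := by
    obtain ⟨-, -, -, -, h3⟩ := hadm.exists_angle
    filter_upwards [h3.eventually_gt_atTop 0, hnear] with ρ h hρ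
    rwa [(hAB ρ hρ).2] at h
  refine ⟨fun z hz => ?_, hadm, hAB, hgauss, fun C _ ε hε =>
    gaussian_relative_error hBpos hgauss C hε⟩
  have h := Complex.hasSum_taylorSeries_on_ball hadm.holomorphic (mem_ball_zero_iff.2 hz)
  refine h.congr_fun fun n => ?_
  rw [taylorCoeffZero, sub_zero, smul_eq_mul, smul_eq_mul]
  ring
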